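/- Consider finite matroids as first-order structures in the countable relational language $\lambda_M$ that has one $k$-ary symbol $I_k$ for every integer $k\ge 1$, where $I_k$ is interpreted as the set of $k$-tuples of distinct elements of the ground set that form an independent set. For a first-order $\lambda_M$-formula $\varphi$ with $k$ free variables and a finite matroid $M$, let $\langle\varphi,M\rangle$ be the proportion of the $k$-tuples of elements of $M$ that satisfy $\varphi$. A sequence $(M_n)_{n\in\mathbb N}$ of finite matroids is first-order convergent if $\langle\varphi,M_n\rangle$ converges for every first-order $\lambda_M$-formula $\varphi$. A limit modeling of $(M_n)$ is a $\lambda_M$-structure $\mathbf M$ such that: (i) the domain of $\mathbf M$ is a standard Borel space equipped with a probability measure $\nu$, and for every $k\ge 0$ and every first-order $\lambda_M$-formula $\varphi$ with $k$ free variables the set $\mathbf M^{\varphi}\subseteq\mathbf M^k$ of tuples satisfying $\varphi$ is measurable with respect to $\nu^k$; (ii) the relations $I_k$ of $\mathbf M$ consist of the independent $k$-tuples of distinct elements of some (possibly infinite, in the sense of Bruhn et al.) matroid on the domain of $\mathbf M$; and (iii) $\nu^k(\mathbf M^{\varphi})=\lim_{n\to\infty}\langle\varphi,M_n\rangle$ for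 every $k\ge 0$ and every first-order $\lambda_M$-formula $\varphi$ with $k$ free variables. Theorem. There exists a first-order convergent sequence of finite matroids of rank three, each representable over $\mathbb Q$, that has no limit modeling. -/

import Mathlib

open Filter Topology MeasureTheory

universe u

/-! ### Modelings, Stone pairings and first order convergence over a first order language -/

/-- The Stone pairing of a formula with `k` free variables and a finite structure: the proportion
of the `k`-tuples of elements that satisfy the formula. -/
noncomputable def finiteStonePairing {L : FirstOrder.Language} (A : Type*) [L.Structure A]
    {k : ℕ} (φ : L.Formula (Fin k)) : ℝ :=
  (Nat.card {v : Fin k → A // φ.Realize v} : ℝ) / (Nat.card A : ℝ) ^ k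

/-- A sequence of (finite) structures is first order convergent if all its Stone pairings
converge. -/
def FOConvergent (L : FirstOrder.Language) (A : ℕ → Type*) [∀ n, L.Structure (A n)] : Prop :=
  ∀ (k : ℕ) (φ : L.Formula (Fin k)), ∃ l : ℝ,
    Tendsto (fun n => finiteStonePairing (A n) φ) atTop (𝓝 l)

/-- A modeling: a structure whose domain is a standard Borel space with a probability measure `ν`
such that every subset of `A ^ k` defined by a first order formula (without parameters) is
measurable with respect to the product measure `ν ^ k`, i.e. belongs to the domain of its
completion; in particular, modelings with Borel definable sets are included. -/
structure FOModeling (L : FirstOrder.Language) where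
  carrier : Type u
  [str : L.Structure carrier]
  [measurableSpace : MeasurableSpace carrier]
  [standardBorel : StandardBorelSpace carrier]
  ν : Measure carrier
  [isProbability : IsProbabilityMeasure ν]
  measurable_definable : ∀ (k : ℕ) (φ : L.Formula (Fin k)),
    NullMeasurableSet {v : Fin k → carrier | φ.Realize v} (Measure.pi fun _ : Fin k => ν)

attribute [instance] FOModeling.str FOModeling.measurableSpace FOModeling.standardBorel
  FOModeling.isProbability

/-- The Stone pairing of a formula with `k` free variables and a modeling: the probability that a
`ν ^ k`-random `k`-tuple satisfies the formula. -/
noncomputable def FOModeling.stonePairing {L : FirstOrder.Language} (A : FOModeling.{u} L)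
    {k : ℕ} (φ : L.Formula (Fin k)) : ℝ :=
  (Measure.pi fun _ : Fin k => A.ν).real {v : Fin k → A.carrier | φ.Realize v}

/-! ### Matroids as first order structures -/

/-- The relation symbols of the language of matroids: one `k`-ary symbol for each positive `k`
(the constructor `indep k` is the symbol of arity `k + 1`). -/
inductive MatroidRel : ℕ → Type
  | indep (k : ℕ) : MatroidRel (k + 1)

/-- The language of matroids. -/
def matroidLanguage : FirstOrder.Language := ⟨fun _ => Empty, MatroidRel⟩

/-- A tuple is independent if its entries are distinct and form an independent set. -/
def Matroid.IndepTuple {α : Type*} (M : Matroid α) {k : ℕ} (v : Fin k → α) : Prop :=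
  Function.Injective v ∧ M.Indep (Set.range v)

/-- A matroid as a structure on its ground set: the `k`-ary symbol is interpreted as the set of
independent `k`-tuples. -/
instance Matroid.structureGround {α : Type*} (M : Matroid α) : matroidLanguage.Structure M.E where
  funMap := fun f => Empty.elim f
  RelMap := fun {k} (_ : MatroidRel k) v => M.IndepTuple fun i => (v i : α)

/-- The structure `A` is a (finite or infinite) matroid with ground set `A`. -/
def IsMatroidStructure (A : Type*) [matroidLanguage.Structure A] : Prop :=
  ∃ N : Matroid A, N.E = Set.univ ∧
    ∀ (k : ℕ) (v : Fin (k + 1) → A),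
      FirstOrder.Language.Structure.RelMap
        (show matroidLanguage.Relations (k + 1) from MatroidRel.indep k) v ↔ N.IndepTuple v

/-- `A` is a limit modeling of the sequence of matroids `M`: it is a matroid, and its Stone
pairings are the limits of the Stone pairings of the matroids in the sequence. -/
def FOModeling.IsMatroidLimitModeling (A : FOModeling.{u} matroidLanguage) {α : ℕ → Type*}
    (M : ∀ n, Matroid (α n)) : Prop :=
  IsMatroidStructure A.carrier ∧
    ∀ (k : ℕ) (φ : matroidLanguage.Formula (Fin k)),
      Tendsto (fun n => finiteStonePairing (M n).E φ) atTop (𝓝 (A.stonePairing φ))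

/-- A (finite) matroid is representable over `F` if its elements can be mapped to vectors over `F`
such that a set of elements is independent iff the family of its images is linearly independent
(so parallel elements may be mapped to the same vector). -/
def Matroid.IsRepresentableOver {α : Type*} (M : Matroid α) (F : Type*) [Field F] : Prop :=
  ∃ (m : ℕ) (f : α → Fin m → F), ∀ I : Set α, I ⊆ M.E → (M.Indep I ↔ LinearIndepOn F f I)

/-!
Let `ν` be a probability measure and `R` a measurable binary relation. The random four-cycle
`v₀v₂`, `v₂v₁`, `v₁v₃`, `v₃v₀` has an even number of edges in `R` with probability
`1 / 2 + 1 / 2 * ∫ codegree ^ 2`, the codegree being that of the `±1`-valued kernel of `R`. If this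
is `1 / 2`, then the codegree vanishes almost everywhere, so the kernel integrates to zero over
every rectangle, hence vanishes almost everywhere, which is absurd. On the other hand, the
probability tends to `1 / 2` along quasirandom graphs, such as the orthogonality graphs over the
field with two elements.

Thus it suffices to encode a finite graph in a matroid of rank three so that adjacency becomes
definable. Represent the vertices by points of a conic, no three of which are collinear, and mark
each edge by two further points of its chord that lie on no other chord: vertices are adjacent if
and only if a third point lies on the line through them. Replacing each vertex by many parallel
copies makes the proportion of the edge points negligible. By compactness, the sequence of these
matroids has a first order convergent subsequence.
-/

section Convergence

open FirstOrder

instance : Countable matroidLanguage.Symbols := by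
  have : Countable (Σ l, MatroidRel l) := by
    refine Function.Surjective.countable
      (f := fun k => (⟨k + 1, MatroidRel.indep k⟩ : Σ l, MatroidRel l)) ?_
    rintro ⟨_, ⟨k⟩⟩
    exact ⟨k, rfl⟩
  exact inferInstanceAs (Countable ((Σ _ : ℕ, Empty) ⊕ Σ l, MatroidRel l))

theorem finiteStonePairing_mem_Icc {L : Language} (A : Type*) [L.Structure A] [Finite A] {k : ℕ}
    (φ : L.Formula (Fin k)) : finiteStonePairing A φ ∈ Set.Icc (0 : ℝ) 1 := by
  refine ⟨by unfold finiteStonePairing; positivity, div_le_one_of_le₀ ?_ (by positivity)⟩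
  have hcard : Nat.card {v : Fin k → A // φ.Realize v} ≤ Nat.card A ^ k := by
    simpa [Nat.card_fun] using Finite.card_subtype_le (α := Fin k → A) fun v => φ.Realize v
  exact_mod_cast hcard

/- The Stone pairings are points of a countable product of compact intervals, which is sequentially
compact. -/
theorem exists_foConvergent_subseq {L : Language} [Countable L.Symbols] (A : ℕ → Type*)
    [∀ n, L.Structure (A n)] [∀ n, Finite (A n)] :
    ∃ s : ℕ → ℕ, StrictMono s ∧ FOConvergent L (fun n => A (s n)) := by
  let x : ℕ → ((p : Σ k : ℕ, L.Formula (Fin k)) → Set.Icc (0 : ℝ) 1) :=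
    fun n p => ⟨finiteStonePairing (A n) p.2, finiteStonePairing_mem_Icc _ _⟩
  obtain ⟨a, -, s, hs, ha⟩ := isCompact_univ.tendsto_subseq (x := x) fun _ => Set.mem_univ _
  refine ⟨s, hs, fun k φ => ⟨a ⟨k, φ⟩, ?_⟩⟩
  exact (continuous_subtype_val.tendsto _).comp (tendsto_pi_nhds.1 ha ⟨k, φ⟩)

end Convergence

section PropSign

open Classical in
/-- The sign `1` or `-1` of a proposition, which turns `↔` into multiplication. -/
noncomputable def propSign (p : Prop) : ℝ := if p then 1 else -1

theorem norm_propSign (p : Prop) : ‖propSign p‖ = 1 := by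
  by_cases p <;> simp_all [propSign]

theorem propSign_iff (p q : Prop) : propSign (p ↔ q) = propSign p * propSign q := by
  by_cases p <;> by_cases q <;> simp_all [propSign]

theorem propSign_not (p : Prop) : propSign (¬ p) = -propSign p := by
  by_cases p <;> simp_all [propSign]

theorem propSign_eq_indicator {Ω : Type*} (p : Ω → Prop) (x : Ω) :
    propSign (p x) = 2 * {x | p x}.indicator 1 x - 1 := by
  by_cases h : p x <;> simp only [propSign, h, Set.indicator, Set.mem_ofPred_eq] <;> norm_num

variable {Ω : Type*} [MeasurableSpace Ω] {μ : Measure Ω} {p q : Ω → Prop}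

theorem aestronglyMeasurable_propSign (hp : NullMeasurableSet {x | p x} μ) :
    AEStronglyMeasurable (fun x => propSign (p x)) μ := by
  simp only [propSign_eq_indicator]
  exact ((aestronglyMeasurable_one.indicator₀ hp).const_mul 2).sub aestronglyMeasurable_const

theorem nullMeasurableSet_setOf_iff (hp : NullMeasurableSet {x | p x} μ)
    (hq : NullMeasurableSet {x | q x} μ) : NullMeasurableSet {x | p x ↔ q x} μ := by
  simp only [iff_iff_and_or_not_and_not]
  exact (hp.inter hq).union (hp.compl.inter hq.compl)

theorem integral_propSign [IsProbabilityMeasure μ] (hp : NullMeasurableSet {x | p x} μ) :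
    ∫ x, propSign (p x) ∂μ = 2 * μ.real {x | p x} - 1 := by
  have hint : Integrable ({x | p x}.indicator (1 : Ω → ℝ)) μ :=
    (integrable_const 1).indicator₀ hp
  simp only [propSign_eq_indicator]
  rw [integral_sub (hint.const_mul 2) (integrable_const 1), integral_const_mul,
    integral_indicator₀ hp]
  simp

end PropSign

section Kernel

variable {X Y : Type*} [MeasurableSpace X] [MeasurableSpace Y] {μ : Measure X} {ν : Measure Y}
  [IsFiniteMeasure μ] [IsFiniteMeasure ν]

theorem ae_eq_zero_of_forall_setIntegral_prod_eq_zero {f : X × Y → ℝ}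
    (hf : Integrable f (μ.prod ν))
    (h : ∀ (S : Set X) (T : Set Y), ∫ p in S ×ˢ T, f p ∂(μ.prod ν) = 0) : f =ᵐ[μ.prod ν] 0 := by
  refine hf.ae_eq_zero_of_forall_setIntegral_eq_zero fun E hE _ => ?_
  induction E, hE using MeasurableSpace.induction_on_inter generateFrom_prod.symm isPiSystem_prod
    with
  | empty => simp
  | basic _ hE =>
    obtain ⟨S, -, T, -, rfl⟩ := hE
    exact h S T
  | compl E hE ih =>
    have huniv : ∫ p, f p ∂(μ.prod ν) = 0 := by simpa using h Set.univ Set.univ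
    simpa [ih, huniv] using integral_add_compl hE hf
  | iUnion E hdisj hE ih =>
    rw [integral_iUnion hE hdisj hf.integrableOn]
    simp [ih]

/-- The codegree of `x` and `x'` in the bipartite graph on `X` and `Y` with edge weights `g`: the
total weight of the paths of length two that join them. -/
noncomputable def codegree (ν : Measure Y) (g : X → Y → ℝ) (x x' : X) : ℝ :=
  ∫ y, g x y * g x' y ∂ν

variable {g : X → Y → ℝ} {C : ℝ}

theorem integrable_mul_of_bound (hg : AEStronglyMeasurable (Function.uncurry g) (μ.prod ν))
    (hC : ∀ x y, ‖g x y‖ ≤ C) :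
    Integrable (fun q : X × Y × Y => g q.1 q.2.1 * g q.1 q.2.2) (μ.prod (ν.prod ν)) := by
  have h₁ : AEStronglyMeasurable (fun q : X × Y × Y => g q.1 q.2.1) (μ.prod (ν.prod ν)) :=
    hg.comp_quasiMeasurePreserving
      (QuasiMeasurePreserving.prodMap (.id μ) Measure.quasiMeasurePreserving_fst)
  have h₂ : AEStronglyMeasurable (fun q : X × Y × Y => g q.1 q.2.2) (μ.prod (ν.prod ν)) :=
    hg.comp_quasiMeasurePreserving
      (QuasiMeasurePreserving.prodMap (.id μ) Measure.quasiMeasurePreserving_snd)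
  refine .of_bound (h₁.mul h₂) (C * C) (ae_of_all _ fun q => ?_)
  exact norm_mul_le_of_le (hC _ _) (hC _ _)

theorem integral_sq_integral (hg : AEStronglyMeasurable (Function.uncurry g) (μ.prod ν))
    (hC : ∀ x y, ‖g x y‖ ≤ C) :
    ∫ x, (∫ y, g x y ∂ν) ^ 2 ∂μ =
      ∫ q : X × Y × Y, g q.1 q.2.1 * g q.1 q.2.2 ∂(μ.prod (ν.prod ν)) := by
  rw [integral_prod _ (integrable_mul_of_bound hg hC)]
  simp only [sq, ← integral_prod_mul]

theorem aestronglyMeasurable_mul_fst (hg : AEStronglyMeasurable (Function.uncurry g) (μ.prod ν)) :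
    AEStronglyMeasurable (Function.uncurry fun (p : X × X) y => g p.1 y * g p.2 y)
      ((μ.prod μ).prod ν) :=
  (hg.comp_quasiMeasurePreserving
      (QuasiMeasurePreserving.prodMap Measure.quasiMeasurePreserving_fst (.id ν))).mul
    (hg.comp_quasiMeasurePreserving
      (QuasiMeasurePreserving.prodMap Measure.quasiMeasurePreserving_snd (.id ν)))

theorem integrable_fourCycle (hg : AEStronglyMeasurable (Function.uncurry g) (μ.prod ν))
    (hC : ∀ x y, ‖g x y‖ ≤ C) :
    Integrable (fun q : (X × X) × (Y × Y) =>
      (g q.1.1 q.2.1 * g q.1.2 q.2.1) * (g q.1.1 q.2.2 * g q.1.2 q.2.2))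
      ((μ.prod μ).prod (ν.prod ν)) :=
  integrable_mul_of_bound (g := fun (p : X × X) y => g p.1 y * g p.2 y)
    (aestronglyMeasurable_mul_fst hg) fun _ _ => norm_mul_le_of_le (hC _ _) (hC _ _)

theorem integral_codegree_sq (hg : AEStronglyMeasurable (Function.uncurry g) (μ.prod ν))
    (hC : ∀ x y, ‖g x y‖ ≤ C) :
    ∫ p, codegree ν g p.1 p.2 ^ 2 ∂(μ.prod μ) =
      ∫ q : (X × X) × (Y × Y), (g q.1.1 q.2.1 * g q.1.2 q.2.1) * (g q.1.1 q.2.2 * g q.1.2 q.2.2)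
        ∂((μ.prod μ).prod (ν.prod ν)) :=
  integral_sq_integral (g := fun (p : X × X) y => g p.1 y * g p.2 y)
    (aestronglyMeasurable_mul_fst hg) fun _ _ => norm_mul_le_of_le (hC _ _) (hC _ _)

theorem integral_sq_integral_eq_integral_codegree
    (hg : AEStronglyMeasurable (Function.uncurry g) (μ.prod ν)) (hC : ∀ x y, ‖g x y‖ ≤ C) :
    ∫ y, (∫ x, g x y ∂μ) ^ 2 ∂ν = ∫ p, codegree ν g p.1 p.2 ∂(μ.prod μ) := by
  rw [integral_sq_integral (g := fun y x => g x y) hg.prod_swap fun y x => hC x y,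
    integral_prod_symm _ (integrable_mul_of_bound hg.prod_swap fun y x => hC x y)]
  rfl

theorem ae_integral_eq_zero_of_ae_codegree_eq_zero
    (hg : AEStronglyMeasurable (Function.uncurry g) (μ.prod ν)) (hC : ∀ x y, ‖g x y‖ ≤ C)
    (h : ∀ᵐ p ∂(μ.prod μ), codegree ν g p.1 p.2 = 0) : ∀ᵐ y ∂ν, ∫ x, g x y ∂μ = 0 := by
  have hsq : ∫ y, (∫ x, g x y ∂μ) ^ 2 ∂ν = 0 := by
    rw [integral_sq_integral_eq_integral_codegree hg hC, integral_eq_zero_of_ae h]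
  have hint : Integrable (fun y => (∫ x, g x y ∂μ) ^ 2) ν := by
    simp only [sq, ← integral_prod_mul]
    exact (integrable_mul_of_bound hg.prod_swap fun y x => hC x y).integral_prod_left
  rw [integral_eq_zero_iff_of_nonneg (fun _ => sq_nonneg _) hint] at hsq
  filter_upwards [hsq] with y hy using pow_eq_zero_iff two_ne_zero |>.1 hy

theorem ae_eq_zero_of_integral_codegree_sq_eq_zero
    (hg : AEStronglyMeasurable (Function.uncurry g) (μ.prod ν)) (hC : ∀ x y, ‖g x y‖ ≤ C)
    (h : ∫ p, codegree ν g p.1 p.2 ^ 2 ∂(μ.prod μ) = 0) :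
    Function.uncurry g =ᵐ[μ.prod ν] 0 := by
  have hint : Integrable (fun p : X × X => codegree ν g p.1 p.2 ^ 2) (μ.prod μ) := by
    simp only [codegree, sq, ← integral_prod_mul]
    exact (integrable_fourCycle hg hC).integral_prod_left
  have hcodeg : ∀ᵐ p ∂(μ.prod μ), codegree ν g p.1 p.2 = 0 := by
    rw [integral_eq_zero_iff_of_nonneg (fun _ => sq_nonneg _) hint] at h
    filter_upwards [h] with p hp using pow_eq_zero_iff two_ne_zero |>.1 hp
  have hgint : Integrable (Function.uncurry g) (μ.prod ν) :=
    .of_bound hg C (ae_of_all _ fun p => hC p.1 p.2)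
  refine ae_eq_zero_of_forall_setIntegral_prod_eq_zero hgint fun S T => ?_
  have hle : μ.restrict S ≪ μ := Measure.restrict_le_self.absolutelyContinuous
  have hmarg : ∀ᵐ y ∂ν, ∫ x in S, g x y ∂μ = 0 :=
    ae_integral_eq_zero_of_ae_codegree_eq_zero (hg.mono_ac (hle.prod .rfl)) hC
      ((hle.prod hle).ae_le hcodeg)
  rw [← Measure.prod_restrict, integral_prod_symm _ (by
    rw [Measure.prod_restrict]; exact hgint.restrict)]
  exact integral_eq_zero_of_ae (ae_restrict_of_ae hmarg)

end Kernel

section EvenCycle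

variable {A : Type*} {R S : A → A → Prop}

/-- An even number of the edges `v₀v₂`, `v₁v₂`, `v₀v₃`, `v₁v₃` of a four-cycle belong to `R`. -/
def EvenCycle (R : A → A → Prop) (v : Fin 4 → A) : Prop :=
  (R (v 0) (v 2) ↔ R (v 1) (v 2)) ↔ (R (v 0) (v 3) ↔ R (v 1) (v 3))

theorem propSign_evenCycle (v : Fin 4 → A) :
    propSign (EvenCycle R v) = (propSign (R (v 0) (v 2)) * propSign (R (v 1) (v 2))) *
      (propSign (R (v 0) (v 3)) * propSign (R (v 1) (v 3))) := by
  simp only [EvenCycle, propSign_iff]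

variable [MeasurableSpace A] {ν : Measure A} [IsProbabilityMeasure ν]

theorem measurePreserving_pair_pi {ι : Type*} [Fintype ι] {i j : ι} (hij : i ≠ j) :
    MeasurePreserving (fun v : ι → A => (v i, v j)) (Measure.pi fun _ => ν) (ν.prod ν) := by
  have hindep := ProbabilityTheory.iIndepFun_pi (μ := fun _ : ι => ν) (X := fun _ x => x)
    (fun _ => aemeasurable_id)
  refine ⟨by fun_prop, ?_⟩
  rw [(ProbabilityTheory.indepFun_iff_map_prod_eq_prod_map_map
    (measurable_pi_apply i).aemeasurable (measurable_pi_apply j).aemeasurable).1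
    (hindep.indepFun hij), (measurePreserving_eval (fun _ : ι => ν) i).map_eq,
    (measurePreserving_eval (fun _ : ι => ν) j).map_eq]

theorem measurePreserving_pairs_pi :
    MeasurePreserving (fun v : Fin 4 → A => ((v 0, v 1), (v 2, v 3))) (Measure.pi fun _ => ν)
      ((ν.prod ν).prod (ν.prod ν)) := by
  have hindep := ProbabilityTheory.iIndepFun_pi (μ := fun _ : Fin 4 => ν) (X := fun _ x => x)
    (fun _ => aemeasurable_id)
  refine ⟨by fun_prop, ?_⟩
  rw [(ProbabilityTheory.indepFun_iff_map_prod_eq_prod_map_map (by fun_prop) (by fun_prop)).1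
    (hindep.indepFun_prodMk_prodMk (fun i => by fun_prop) 0 1 2 3 (by decide) (by decide)
      (by decide) (by decide)),
    (measurePreserving_pair_pi (ν := ν) (by decide : (0 : Fin 4) ≠ 1)).map_eq,
    (measurePreserving_pair_pi (ν := ν) (by decide : (2 : Fin 4) ≠ 3)).map_eq]

theorem measureReal_evenCycle (hR : NullMeasurableSet {p : A × A | R p.1 p.2} (ν.prod ν)) :
    (Measure.pi fun _ : Fin 4 => ν).real {v | EvenCycle R v} =
      1 / 2 + 1 / 2 * ∫ p, codegree ν (fun x y => propSign (R x y)) p.1 p.2 ^ 2 ∂(ν.prod ν) := by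
  have hpair {i j : Fin 4} (hij : i ≠ j) :
      NullMeasurableSet {v : Fin 4 → A | R (v i) (v j)} (Measure.pi fun _ => ν) :=
    hR.preimage (measurePreserving_pair_pi hij).quasiMeasurePreserving
  have hcycle : NullMeasurableSet {v | EvenCycle R v} (Measure.pi fun _ : Fin 4 => ν) :=
    nullMeasurableSet_setOf_iff
      (nullMeasurableSet_setOf_iff (hpair (by decide)) (hpair (by decide)))
      (nullMeasurableSet_setOf_iff (hpair (by decide)) (hpair (by decide)))
  have hint := integral_propSign hcycle
  simp only [propSign_evenCycle] at hint
  have hsign := aestronglyMeasurable_propSign hR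
  have hkernel := integrable_fourCycle hsign fun _ _ => (norm_propSign _).le
  have hpairs := measurePreserving_pairs_pi (ν := ν)
  rw [← hpairs.map_eq] at hkernel
  rw [integral_codegree_sq hsign fun _ _ => (norm_propSign _).le, ← hpairs.map_eq,
    integral_map hpairs.aemeasurable hkernel.aestronglyMeasurable]
  linarith

theorem measureReal_evenCycle_ne_half
    (hR : NullMeasurableSet {p : A × A | R p.1 p.2} (ν.prod ν)) :
    (Measure.pi fun _ : Fin 4 => ν).real {v | EvenCycle R v} ≠ 1 / 2 := by
  intro h
  have hzero := ae_eq_zero_of_integral_codegree_sq_eq_zero (aestronglyMeasurable_propSign hR)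
    (fun _ _ => (norm_propSign _).le) (by linarith [measureReal_evenCycle hR])
  obtain ⟨p, hp⟩ := hzero.exists
  have hnorm := norm_propSign (R p.1 p.2)
  rw [show propSign (R p.1 p.2) = 0 from hp, norm_zero] at hnorm
  exact zero_ne_one hnorm

theorem measureReal_evenCycle_le_add :
    (Measure.pi fun _ : Fin 4 => ν).real {v | EvenCycle R v} ≤
      (Measure.pi fun _ : Fin 4 => ν).real {v | EvenCycle S v} +
        4 * (ν.prod ν).real {p | ¬ (R p.1 p.2 ↔ S p.1 p.2)} := by
  set P := Measure.pi fun _ : Fin 4 => ν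
  let D (i j : Fin 4) : Set (Fin 4 → A) := {v | ¬ (R (v i) (v j) ↔ S (v i) (v j))}
  have hD {i j : Fin 4} (hij : i ≠ j) :
      P.real (D i j) ≤ (ν.prod ν).real {p | ¬ (R p.1 p.2 ↔ S p.1 p.2)} := by
    have hpair := measurePreserving_pair_pi (ν := ν) hij
    rw [← hpair.map_eq]
    exact ENNReal.toReal_mono (measure_ne_top _ _) (Measure.le_map_apply hpair.aemeasurable _)
  have hsub : {v | EvenCycle R v} ⊆ {v | EvenCycle S v} ∪ ((D 0 2 ∪ D 1 2) ∪ (D 0 3 ∪ D 1 3)) := by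
    intro v hv
    by_contra hcon
    simp only [D, Set.mem_union, Set.mem_ofPred_eq, not_or, not_not] at hcon
    obtain ⟨hS, ⟨h02, h12⟩, h03, h13⟩ := hcon
    exact hS (by simpa only [EvenCycle, Set.mem_ofPred_eq, h02, h12, h03, h13] using hv)
  calc P.real {v | EvenCycle R v}
      ≤ P.real {v | EvenCycle S v} +
          ((P.real (D 0 2) + P.real (D 1 2)) + (P.real (D 0 3) + P.real (D 1 3))) := by
        refine (measureReal_mono hsub).trans ((measureReal_union_le _ _).trans ?_)
        gcongr
        refine (measureReal_union_le _ _).trans ?_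
        gcongr <;> exact measureReal_union_le _ _
    _ ≤ _ := by
        linarith [hD (by decide : (0 : Fin 4) ≠ 2), hD (by decide : (1 : Fin 4) ≠ 2),
          hD (by decide : (0 : Fin 4) ≠ 3), hD (by decide : (1 : Fin 4) ≠ 3)]

theorem abs_measureReal_evenCycle_sub_le :
    |(Measure.pi fun _ : Fin 4 => ν).real {v | EvenCycle R v} -
        (Measure.pi fun _ : Fin 4 => ν).real {v | EvenCycle S v}| ≤
      4 * (ν.prod ν).real {p | ¬ (R p.1 p.2 ↔ S p.1 p.2)} := by
  have hle := measureReal_evenCycle_le_add (ν := ν) (R := R) (S := S)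
  have hge := measureReal_evenCycle_le_add (ν := ν) (R := S) (S := R)
  simp only [iff_comm (a := S _ _)] at hge
  rw [abs_sub_le_iff]
  constructor <;> linarith

end EvenCycle

section Formula

open FirstOrder Language Structure

/-- The binary symbol `I₂` of the language of matroids. -/
def indepPairSymbol : matroidLanguage.Relations 2 := MatroidRel.indep 1

/-- The ternary symbol `I₃` of the language of matroids. -/
def indepTripleSymbol : matroidLanguage.Relations 3 := MatroidRel.indep 2

/-- Adjacency of elements of a matroid: `x` and `y` are independent and the line through them
contains an element that is parallel to neither of them. -/
def LineAdj {A : Type*} [matroidLanguage.Structure A] (x y : A) : Prop :=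
  RelMap indepPairSymbol ![x, y] ∧
    ∃ z, RelMap indepPairSymbol ![x, z] ∧ RelMap indepPairSymbol ![y, z] ∧
      ¬ RelMap indepTripleSymbol ![x, y, z]

/-- The formula that defines `LineAdj`, in the free variables `i` and `j`. -/
def lineAdjFormula {ι : Type*} (i j : ι) : matroidLanguage.Formula ι :=
  indepPairSymbol.formula₂ (Term.var i) (Term.var j) ⊓
    BoundedFormula.ex (n := 0)
      (indepPairSymbol.boundedFormula₂ (Term.var (Sum.inl i)) (Term.var (Sum.inr 0)) ⊓
        (indepPairSymbol.boundedFormula₂ (Term.var (Sum.inl j)) (Term.var (Sum.inr 0)) ⊓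
          (indepTripleSymbol.boundedFormula ![Term.var (Sum.inl i), Term.var (Sum.inl j),
            Term.var (Sum.inr 0)]).not))

variable {A : Type*} [matroidLanguage.Structure A]

theorem realize_lineAdjFormula {ι : Type*} (i j : ι) (v : ι → A) :
    (lineAdjFormula i j).Realize v ↔ LineAdj (v i) (v j) := by
  rw [lineAdjFormula, Formula.realize_inf, Formula.realize_rel₂, LineAdj, Formula.Realize,
    BoundedFormula.realize_ex]
  refine and_congr_right' (exists_congr fun z => ?_)
  rw [BoundedFormula.realize_inf, BoundedFormula.realize_inf, BoundedFormula.realize_not,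
    BoundedFormula.realize_rel₂, BoundedFormula.realize_rel₂, BoundedFormula.realize_rel]
  refine and_congr_right' (and_congr_right' (not_congr (iff_of_eq (congrArg _ ?_))))
  funext k
  fin_cases k <;> rfl

/-- The formula stating that an even number of the edges `v₀v₂`, `v₁v₂`, `v₀v₃`, `v₁v₃` are adjacent
pairs. -/
def evenCycleFormula : matroidLanguage.Formula (Fin 4) :=
  ((lineAdjFormula 0 2).iff (lineAdjFormula 1 2)).iff
    ((lineAdjFormula 0 3).iff (lineAdjFormula 1 3))

theorem realize_evenCycleFormula (v : Fin 4 → A) :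
    evenCycleFormula.Realize v ↔ EvenCycle LineAdj v := by
  simp only [evenCycleFormula, Formula.realize_iff, realize_lineAdjFormula, EvenCycle]

theorem measureReal_realize_evenCycleFormula_ne_half [MeasurableSpace A] {ν : Measure A}
    [IsProbabilityMeasure ν]
    (h : NullMeasurableSet {v : Fin 2 → A | (lineAdjFormula 0 1).Realize v}
      (Measure.pi fun _ => ν)) :
    (Measure.pi fun _ : Fin 4 => ν).real {v | evenCycleFormula.Realize v} ≠ 1 / 2 := by
  simp only [realize_lineAdjFormula] at h
  simp only [realize_evenCycleFormula]
  exact measureReal_evenCycle_ne_half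
    (h.preimage (measurePreserving_finTwoArrow ν).symm.quasiMeasurePreserving)

end Formula

section Uniform

open FirstOrder ProbabilityTheory

variable {α β : Type*} [Finite α] [MeasurableSpace α] [MeasurableSingletonClass α]
  [Finite β] [MeasurableSpace β] [MeasurableSingletonClass β]

theorem uniformOn_univ_apply (s : Set α) : uniformOn Set.univ s = s.ncard / Nat.card α := by
  have := Fintype.ofFinite α
  rw [uniformOn_univ, Measure.count_apply s.toFinite.measurableSet, Nat.card_eq_fintype_card,
    ← s.toFinite.cast_ncard_eq]
  rfl

theorem measureReal_uniformOn_univ (s : Set α) :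
    (uniformOn Set.univ).real s = s.ncard / Nat.card α := by
  rw [Measure.real, uniformOn_univ_apply, ENNReal.toReal_div, ENNReal.toReal_natCast,
    ENNReal.toReal_natCast]

theorem uniformOn_univ_prod :
    uniformOn (Set.univ : Set (α × β)) = (uniformOn Set.univ).prod (uniformOn Set.univ) := by
  refine Measure.ext_of_singleton fun p => ?_
  rw [← Set.singleton_prod_singleton, Measure.prod_prod, Set.singleton_prod_singleton]
  simp only [uniformOn_univ_apply, Set.ncard_singleton, Nat.card_prod, Nat.cast_mul, Nat.cast_one,
    one_div]
  exact ENNReal.mul_inv (.inr (ENNReal.natCast_ne_top _)) (.inl (ENNReal.natCast_ne_top _))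

theorem measurePreserving_uniformOn_univ (e : α ≃ β) :
    MeasurePreserving e (uniformOn Set.univ) (uniformOn Set.univ) := by
  refine ⟨measurable_of_finite e, Measure.ext_of_singleton fun b => ?_⟩
  rw [Measure.map_apply (measurable_of_finite e) (measurableSet_singleton b), uniformOn_univ_apply,
    uniformOn_univ_apply, Nat.card_congr e, ← e.image_symm_eq_preimage, Set.image_singleton,
    Set.ncard_singleton, Set.ncard_singleton]

theorem measureReal_uniformOn_univ_diagonal :
    ((uniformOn Set.univ).prod (uniformOn Set.univ)).real {p : α × α | p.1 = p.2} =
      (Nat.card α : ℝ)⁻¹ := by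
  have hdiag : {p : α × α | p.1 = p.2} = Set.range fun a => (a, a) := by
    ext ⟨a, b⟩
    simp [Prod.ext_iff, eq_comm]
  rw [← uniformOn_univ_prod, measureReal_uniformOn_univ, hdiag,
    Set.ncard_range_of_injective fun a b h => congrArg Prod.fst h, Nat.card_prod, Nat.cast_mul,
    div_self_mul_self']

instance {α β : Type*} [MeasurableSpace α] [MeasurableSingletonClass α] [MeasurableSpace β]
    [MeasurableSingletonClass β] : MeasurableSingletonClass (α ⊕ β) where
  measurableSet_singleton := by
    rintro (a | b)
    · rw [← Set.image_singleton]
      exact (measurableSet_singleton a).inl_image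
    · rw [← Set.image_singleton]
      exact (measurableSet_singleton b).inr_image

theorem measureReal_uniformOn_univ_range_inr :
    (uniformOn Set.univ).real (Set.range (Sum.inr : β → α ⊕ β)) =
      Nat.card β / (Nat.card α + Nat.card β) := by
  rw [measureReal_uniformOn_univ, Set.ncard_range_of_injective Sum.inr_injective, Nat.card_sum,
    Nat.cast_add]

theorem finiteStonePairing_eq_measureReal {L : Language} {A : Type*} [L.Structure A] (e : α ≃ A)
    {k : ℕ} (φ : L.Formula (Fin k)) :
    finiteStonePairing A φ =
      (Measure.pi fun _ : Fin k => uniformOn (Set.univ : Set α)).real {v | φ.Realize (e ∘ v)} := by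
  rw [← uniformOn_pi, Set.pi_univ, measureReal_uniformOn_univ, finiteStonePairing,
    Nat.card_fun, Nat.card_fin, Nat.card_congr e, Nat.cast_pow, ← Nat.card_coe_set_eq,
    ← Nat.card_congr ((Equiv.arrowCongr (.refl (Fin k)) e).subtypeEquiv fun v => Iff.rfl)]
  rfl

end Uniform

section VectorMatroid

open FirstOrder.Language.Structure

variable {α F W : Type*} [Field F] [AddCommGroup W] [Module F W] {f : α → W}

theorem exists_linearIndepOn_insert_of_encard_lt {I J : Set α} (hI : LinearIndepOn F f I)
    (hJ : LinearIndepOn F f J) (hIJ : I.encard < J.encard) :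
    ∃ e ∈ J, e ∉ I ∧ LinearIndepOn F f (insert e I) := by
  by_contra! hcon
  have hspan : Submodule.span F (f '' J) ≤ Submodule.span F (f '' I) := by
    rw [Submodule.span_le]
    rintro _ ⟨e, heJ, rfl⟩
    by_cases heI : e ∈ I
    · exact Submodule.subset_span ⟨e, heI, rfl⟩
    · by_contra hne
      exact hcon e heJ heI (hI.insert hne)
  refine hIJ.not_ge ?_
  rw [← toENat_rank_span_set hI, ← toENat_rank_span_set hJ]
  exact OrderHomClass.mono _ (Submodule.rank_mono hspan)

/-- The matroid of linear independence of a family of vectors. -/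
def vectorMatroid (F : Type*) [Field F] [Module F W] (f : α → W) : Matroid α :=
  (IndepMatroid.ofFinitaryCardAugment Set.univ (LinearIndepOn F f) (linearIndepOn_empty F f)
    (fun _ _ hJ hIJ => hJ.mono hIJ)
    (fun I J hI hIfin hJ hJfin hIJ => exists_linearIndepOn_insert_of_encard_lt hI hJ <| by
      rwa [← hIfin.cast_ncard_eq, ← hJfin.cast_ncard_eq, Nat.cast_lt])
    (fun I h => linearIndepOn_of_finite I h)
    (fun _ _ => Set.subset_univ _)).matroid

theorem eRank_vectorMatroid :
    (vectorMatroid F f).eRank = (Module.rank F (Submodule.span F (Set.range f))).toENat := by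
  obtain ⟨B, hB⟩ := (vectorMatroid F f).exists_isBase
  have hBindep : LinearIndepOn F f B := hB.indep
  have hspan : Submodule.span F (f '' B) = Submodule.span F (Set.range f) := by
    refine le_antisymm (Submodule.span_mono (Set.image_subset_range f B)) ?_
    rw [Submodule.span_le]
    rintro _ ⟨e, rfl⟩
    by_cases heB : e ∈ B
    · exact Submodule.subset_span ⟨e, heB, rfl⟩
    · by_contra hne
      exact (hB.insert_dep ⟨Set.mem_univ e, heB⟩).not_indep (hBindep.insert hne)
  rw [← hB.encard_eq_eRank, ← hspan, toENat_rank_span_set hBindep]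

theorem indepTuple_vectorMatroid_iff {k : ℕ} (v : Fin k → α) :
    (vectorMatroid F f).IndepTuple v ↔ LinearIndependent F (f ∘ v) := by
  refine ⟨fun ⟨hv, h⟩ => (linearIndepOn_range_iff hv f).1 h, fun h => ?_⟩
  have hv : Function.Injective v := h.injective.of_comp
  exact ⟨hv, (linearIndepOn_range_iff hv f).2 h⟩

theorem relMap_indepPairSymbol_vectorMatroid (a b : (vectorMatroid F f).E) :
    RelMap indepPairSymbol ![a, b] ↔ LinearIndependent F ![f a, f b] := by
  refine (indepTuple_vectorMatroid_iff _).trans (iff_of_eq ?_)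
  congr 1
  funext i
  fin_cases i <;> rfl

theorem relMap_indepTripleSymbol_vectorMatroid (a b c : (vectorMatroid F f).E) :
    RelMap indepTripleSymbol ![a, b, c] ↔ LinearIndependent F ![f a, f b, f c] := by
  refine (indepTuple_vectorMatroid_iff _).trans (iff_of_eq ?_)
  congr 1
  funext i
  fin_cases i <;> rfl

theorem lineAdj_vectorMatroid_iff (a b : (vectorMatroid F f).E) :
    LineAdj a b ↔ LinearIndependent F ![f a, f b] ∧
      ∃ z, LinearIndependent F ![f a, f z] ∧ LinearIndependent F ![f b, f z] ∧
        ¬ LinearIndependent F ![f a, f b, f z] := by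
  simp only [LineAdj, relMap_indepPairSymbol_vectorMatroid, relMap_indepTripleSymbol_vectorMatroid]
  exact and_congr_right' ⟨fun ⟨z, hz⟩ => ⟨z, hz⟩, fun ⟨z, hz⟩ => ⟨⟨z, Set.mem_univ z⟩, hz⟩⟩

end VectorMatroid

section MomentCurve

variable {F : Type*} [Field F]

/-- The points of the moment curve in the projective plane, no three of which are collinear. -/
def momentPoint (t : F) : Fin 3 → F := ![1, t, t ^ 2]

theorem linearIndependent_triple_iff_det_ne_zero (a b c : Fin 3 → F) :
    LinearIndependent F ![a, b, c] ↔ (Matrix.of ![a, b, c]).det ≠ 0 := by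
  rw [← isUnit_iff_ne_zero, ← Matrix.isUnit_iff_isUnit_det,
    ← Matrix.linearIndependent_rows_iff_isUnit]
  rfl

theorem linearIndependent_momentPoint_add_smul_iff (x y z w c : F) :
    LinearIndependent F ![momentPoint x, momentPoint y, momentPoint z + c • momentPoint w] ↔
      (y - x) * ((z - x) * (z - y) + c * ((w - x) * (w - y))) ≠ 0 := by
  rw [linearIndependent_triple_iff_det_ne_zero, Matrix.det_fin_three]
  refine not_congr (iff_of_eq (congrArg (· = 0) ?_))
  simp only [momentPoint, Matrix.of_apply, Matrix.cons_val, Pi.add_apply, Pi.smul_apply,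
    smul_eq_mul]
  ring

theorem linearIndependent_momentPoint_triple_iff (x y z : F) :
    LinearIndependent F ![momentPoint x, momentPoint y, momentPoint z] ↔
      x ≠ y ∧ x ≠ z ∧ y ≠ z := by
  have h := linearIndependent_momentPoint_add_smul_iff x y z 0 0
  simp only [zero_smul, add_zero, zero_mul, mul_ne_zero_iff, sub_ne_zero] at h
  rw [h, ne_comm (a := y), ne_comm (a := z), ne_comm (a := z)]

theorem linearIndependent_momentPoint_pair_iff {x y : F} :
    LinearIndependent F ![momentPoint x, momentPoint y] ↔ x ≠ y := by
  refine ⟨fun h hxy => ?_, fun hxy => LinearIndependent.pair_iff.2 fun s t hst => ?_⟩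
  · exact absurd (h.injective (a₁ := 0) (a₂ := 1) (by simp [hxy])) zero_ne_one
  · have h0 : s + t = 0 := by simpa [momentPoint] using congrFun hst 0
    have h1 : s * x + t * y = 0 := by simpa [momentPoint] using congrFun hst 1
    have hmul : t * (y - x) = 0 := by linear_combination h1 - x * h0
    have ht : t = 0 := (mul_eq_zero.1 hmul).resolve_right (sub_ne_zero.2 hxy.symm)
    exact ⟨by simpa [ht] using h0, ht⟩

/-- The ratio `c` is generic for the points `τ i` of the moment curve if dividing each chord in this
ratio gives points that lie on no other chord. -/
def IsGenericRatio {V : Type*} (τ : V → F) (c : F) : Prop :=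
  c ≠ 0 ∧ ∀ i k l j, i ≠ k → l ≠ j →
    ¬ LinearIndependent F ![momentPoint (τ i), momentPoint (τ k),
      momentPoint (τ l) + c • momentPoint (τ j)] → s(l, j) = s(i, k)

theorem exists_isGenericRatio [Infinite F] {V : Type*} [Finite V] {τ : V → F}
    (hτ : Function.Injective τ) : ∃ c, IsGenericRatio τ c := by
  let bad (q : V × V × V × V) : F :=
    -((τ q.2.2.1 - τ q.1) * (τ q.2.2.1 - τ q.2.1)) /
      ((τ q.2.2.2 - τ q.1) * (τ q.2.2.2 - τ q.2.1))
  obtain ⟨c, hc⟩ := ((Set.finite_range bad).union (Set.finite_singleton 0)).infinite_compl.nonempty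
  simp only [Set.mem_compl_iff, Set.mem_union, Set.mem_range, Set.mem_singleton_iff, not_or,
    not_exists] at hc
  refine ⟨c, hc.2, fun i k l j hik hlj h => ?_⟩
  rw [linearIndependent_momentPoint_add_smul_iff, not_not, mul_eq_zero,
    or_iff_right (sub_ne_zero.2 (hτ.ne hik.symm))] at h
  by_cases hj : (τ j - τ i) * (τ j - τ k) = 0
  · rw [hj, mul_zero, add_zero] at h
    simp only [mul_eq_zero, sub_eq_zero, hτ.eq_iff] at h hj
    grind
  · refine absurd ?_ (hc.1 (i, k, l, j))
    rw [div_eq_iff hj]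
    linear_combination -h

end MomentCurve

section GraphMatroid

variable {V C F : Type*} [Field F] {G : SimpleGraph V} {τ : V → F} {c : F}

open Classical in
/-- The vectors of the graph matroid: copies of the moment point of each `i : V`, indexed by `C`,
and, for each edge of `G`, the two points that divide its chord in the ratio `c`. The index of a
pair that is not an edge is mapped to `0`. -/
noncomputable def graphVector (G : SimpleGraph V) (τ : V → F) (c : F) : V × (C ⊕ V) → Fin 3 → F
  | (i, .inl _) => momentPoint (τ i)
  | (i, .inr j) => if G.Adj i j then momentPoint (τ i) + c • momentPoint (τ j) else 0

/-- A matroid of rank at most three in which a graph is definable: two copies of vertices are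
`LineAdj` if and only if the vertices are adjacent. -/
noncomputable def graphMatroid (C : Type*) (G : SimpleGraph V) (τ : V → F) (c : F) :
    Matroid (V × (C ⊕ V)) :=
  vectorMatroid F (graphVector G τ c)

theorem eRank_graphMatroid [Nonempty C] (hτ : Function.Injective τ) {i j k : V} (hij : i ≠ j)
    (hik : i ≠ k) (hjk : j ≠ k) : (graphMatroid C G τ c).eRank = 3 := by
  inhabit C
  have hindep : LinearIndependent F ![momentPoint (τ i), momentPoint (τ j), momentPoint (τ k)] :=
    (linearIndependent_momentPoint_triple_iff _ _ _).2 ⟨hτ.ne hij, hτ.ne hik, hτ.ne hjk⟩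
  have hspan : Submodule.span F (Set.range (graphVector (C := C) G τ c)) = ⊤ := by
    rw [eq_top_iff, ← hindep.span_eq_top_of_card_eq_finrank' (by simp)]
    refine Submodule.span_mono (Set.range_subset_iff.2 fun n => ?_)
    fin_cases n
    exacts [⟨(i, .inl default), rfl⟩, ⟨(j, .inl default), rfl⟩, ⟨(k, .inl default), rfl⟩]
  rw [graphMatroid, eRank_vectorMatroid, hspan, rank_top]
  simp

theorem lineAdj_graphMatroid_iff (hτ : Function.Injective τ) (hc : IsGenericRatio τ c)
    {a b : (graphMatroid C G τ c).E} {i k : V} {p q : C} (ha : a.1 = (i, .inl p))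
    (hb : b.1 = (k, .inl q)) : LineAdj a b ↔ G.Adj i k := by
  refine (lineAdj_vectorMatroid_iff a b).trans ?_
  simp only [ha, hb, graphVector, linearIndependent_momentPoint_pair_iff]
  constructor
  · rintro ⟨hik, ⟨l, z | j⟩, hil, hkl, hdep⟩
    · simp only [linearIndependent_momentPoint_pair_iff,
        linearIndependent_momentPoint_triple_iff] at hil hkl hdep
      exact absurd ⟨hik, hil, hkl⟩ hdep
    · by_cases hlj : G.Adj l j
      · simp only [if_pos hlj] at hdep
        have hedge := hc.2 i k l j (ne_of_apply_ne τ hik) hlj.ne hdep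
        rwa [← SimpleGraph.mem_edgeSet, ← hedge, SimpleGraph.mem_edgeSet]
      · exact absurd (by simp [hlj]) (hil.ne_zero 1)
  · intro hadj
    have hik := hτ.ne hadj.ne
    have hpair := linearIndependent_momentPoint_pair_iff.2 hik
    refine ⟨hik, (i, .inr k), ?_⟩
    simp only [if_pos hadj]
    refine ⟨?_, ?_, ?_⟩
    · simpa [hpair, hc.1] using LinearIndependent.pair_add_smul_add_smul_iff (R := F)
        (x := momentPoint (τ i)) (y := momentPoint (τ k)) 1 0 1 c
    · simpa [hpair] using LinearIndependent.pair_add_smul_add_smul_iff (R := F)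
        (x := momentPoint (τ i)) (y := momentPoint (τ k)) 0 1 1 c
    · simp [linearIndependent_momentPoint_add_smul_iff]

end GraphMatroid

section Orthogonality

open ProbabilityTheory

variable {ι : Type*} [Fintype ι]

/-- Distinct vectors over the field with two elements are adjacent if they are orthogonal. These
graphs are quasirandom of density one half. -/
def orthogonalityGraph (ι : Type*) [Fintype ι] : SimpleGraph (ι → ZMod 2) where
  Adj x y := x ≠ y ∧ x ⬝ᵥ y = 0
  symm := ⟨fun x y h => ⟨h.1.symm, dotProduct_comm x y ▸ h.2⟩⟩
  loopless := ⟨fun _ h => h.1 rfl⟩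

theorem propSign_add_eq_zero (a b : ZMod 2) :
    propSign (a + b = 0) = propSign (a = 0) * propSign (b = 0) := by
  rw [← propSign_iff]
  congr 1
  revert a b
  decide

theorem integral_propSign_dotProduct_of_ne_zero {x : ι → ZMod 2} (hx : x ≠ 0) :
    ∫ y, propSign (x ⬝ᵥ y = 0) ∂uniformOn Set.univ = 0 := by
  classical
  obtain ⟨i, hi⟩ := Function.ne_iff.1 hx
  have hshift := measurePreserving_uniformOn_univ 
    (Equiv.addRight (Pi.single i 1 : ι → ZMod 2))
  have hflip (y : ι → ZMod 2) : propSign (x ⬝ᵥ (y + Pi.single i 1) = 0) =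
      -propSign (x ⬝ᵥ y = 0) := by
    rw [← propSign_not, dotProduct_add, dotProduct_single_one]
    have hval (a b : ZMod 2) : b ≠ 0 → ((a + b = 0) = ¬ a = 0) := by
      revert a b
      decide
    exact congrArg propSign (hval _ _ hi)
  have hint := hshift.integral_comp
    ⟨Equiv.injective _, hshift.measurable, fun s _ => (Set.toFinite _).measurableSet⟩
    fun y => propSign (x ⬝ᵥ y = 0)
  simp only [Equiv.coe_addRight, hflip, integral_neg] at hint
  linarith

open Classical in
theorem codegree_propSign_dotProduct (x x' : ι → ZMod 2) :
    codegree (uniformOn Set.univ) (fun x y : ι → ZMod 2 => propSign (x ⬝ᵥ y = 0)) x x' =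
      if x = x' then 1 else 0 := by
  have hadd : x + x' = 0 ↔ x = x' := by
    simp only [funext_iff, Pi.add_apply, Pi.zero_apply, CharTwo.add_eq_zero]
  simp only [codegree, ← propSign_add_eq_zero, ← add_dotProduct]
  split_ifs with h
  · simp [hadd.2 h, propSign]
  · exact integral_propSign_dotProduct_of_ne_zero (mt hadd.1 h)

theorem measureReal_evenCycle_dotProduct :
    (Measure.pi fun _ : Fin 4 => uniformOn (Set.univ : Set (ι → ZMod 2))).real
      {v | EvenCycle (fun x y => x ⬝ᵥ y = 0) v} =
        1 / 2 + 1 / 2 * (Nat.card (ι → ZMod 2) : ℝ)⁻¹ := by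
  classical
  have hdiag (p : (ι → ZMod 2) × (ι → ZMod 2)) :
      (if p.1 = p.2 then 1 else 0 : ℝ) ^ 2 = {p | p.1 = p.2}.indicator 1 p := by
    by_cases h : p.1 = p.2 <;> simp [h]
  rw [measureReal_evenCycle (Set.toFinite _).measurableSet.nullMeasurableSet]
  simp only [codegree_propSign_dotProduct, hdiag]
  rw [integral_indicator_one (Set.toFinite _).measurableSet, measureReal_uniformOn_univ_diagonal]

theorem abs_measureReal_evenCycle_orthogonalityGraph_sub_le :
    |(Measure.pi fun _ : Fin 4 => uniformOn (Set.univ : Set (ι → ZMod 2))).real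
      {v | EvenCycle (orthogonalityGraph ι).Adj v} - 1 / 2| ≤
        9 / 2 * (Nat.card (ι → ZMod 2) : ℝ)⁻¹ := by
  set μ := uniformOn (Set.univ : Set (ι → ZMod 2))
  have hloop : {p : (ι → ZMod 2) × (ι → ZMod 2) |
      ¬ ((orthogonalityGraph ι).Adj p.1 p.2 ↔ p.1 ⬝ᵥ p.2 = 0)} ⊆ {p | p.1 = p.2} := by
    intro p hp
    by_contra hne
    have hne : p.1 ≠ p.2 := hne
    exact hp (and_iff_right hne)
  have hdiff := (abs_measureReal_evenCycle_sub_le (ν := μ) (R := (orthogonalityGraph ι).Adj)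
    (S := fun x y => x ⬝ᵥ y = 0)).trans
      (mul_le_mul_of_nonneg_left (measureReal_mono hloop) zero_le_four)
  rw [measureReal_evenCycle_dotProduct, measureReal_uniformOn_univ_diagonal, abs_le] at hdiff
  have hcard : 0 ≤ (Nat.card (ι → ZMod 2) : ℝ)⁻¹ := by positivity
  exact abs_le.2 ⟨by linarith [hdiff.1, hcard], by linarith [hdiff.2, hcard]⟩

end Orthogonality

section Approximation

open ProbabilityTheory

variable {V C F : Type*} [Finite V] [MeasurableSpace V] [MeasurableSingletonClass V] [Nonempty V]
  [Finite C] [MeasurableSpace C] [MeasurableSingletonClass C] [Field F] {G : SimpleGraph V}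
  {τ : V → F} {c : F}

theorem measureReal_lineAdj_graphMatroid_ne_adj_le (hτ : Function.Injective τ)
    (hc : IsGenericRatio τ c) (e : V × (C ⊕ V) ≃ (graphMatroid C G τ c).E)
    (he : ∀ a, (e a).1 = a) :
    ((uniformOn Set.univ).prod (uniformOn Set.univ)).real {p : (V × (C ⊕ V)) × (V × (C ⊕ V)) |
        ¬ (LineAdj (e p.1) (e p.2) ↔ G.Adj p.1.1 p.2.1)} ≤
      2 * (Nat.card V / (Nat.card C + Nat.card V)) := by
  set μ := uniformOn (Set.univ : Set (V × (C ⊕ V))) with hμ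
  let B : Set (V × (C ⊕ V)) := Prod.snd ⁻¹' Set.range Sum.inr
  have hB : μ.real B = Nat.card V / (Nat.card C + Nat.card V) := by
    rw [hμ, uniformOn_univ_prod, measurePreserving_snd.measureReal_preimage
      (Set.toFinite _).measurableSet.nullMeasurableSet, measureReal_uniformOn_univ_range_inr]
  have hsub : {p : (V × (C ⊕ V)) × (V × (C ⊕ V)) |
      ¬ (LineAdj (e p.1) (e p.2) ↔ G.Adj p.1.1 p.2.1)} ⊆ Prod.fst ⁻¹' B ∪ Prod.snd ⁻¹' B := by
    rintro ⟨⟨i, p | j⟩, ⟨k, q | l⟩⟩ hp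
    · exact absurd (lineAdj_graphMatroid_iff hτ hc (he _) (he _)) hp
    · exact .inr ⟨l, rfl⟩
    · exact .inl ⟨j, rfl⟩
    · exact .inl ⟨j, rfl⟩
  have hBmeas : NullMeasurableSet B μ := (Set.toFinite _).measurableSet.nullMeasurableSet
  calc _ ≤ (μ.prod μ).real (Prod.fst ⁻¹' B) + (μ.prod μ).real (Prod.snd ⁻¹' B) :=
        (measureReal_mono hsub).trans (measureReal_union_le _ _)
    _ = 2 * (Nat.card V / (Nat.card C + Nat.card V)) := by
        rw [measurePreserving_fst.measureReal_preimage hBmeas,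
          measurePreserving_snd.measureReal_preimage hBmeas, hB, two_mul]

theorem abs_finiteStonePairing_graphMatroid_sub_le (hτ : Function.Injective τ)
    (hc : IsGenericRatio τ c) :
    |finiteStonePairing (graphMatroid C G τ c).E evenCycleFormula -
        (Measure.pi fun _ : Fin 4 => uniformOn (Set.univ : Set V)).real {v | EvenCycle G.Adj v}| ≤
      8 * (Nat.card V / (Nat.card C + Nat.card V)) := by
  let e : V × (C ⊕ V) ≃ (graphMatroid C G τ c).E := (Equiv.Set.univ _).symm
  set μ := uniformOn (Set.univ : Set (V × (C ⊕ V))) with hμ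
  have hfst : MeasurePreserving Prod.fst μ (uniformOn Set.univ) := by
    rw [hμ, uniformOn_univ_prod]
    exact measurePreserving_fst
  have hpull : (Measure.pi fun _ : Fin 4 => uniformOn (Set.univ : Set V)).real
        {v | EvenCycle G.Adj v} =
      (Measure.pi fun _ : Fin 4 => μ).real {v | EvenCycle (fun a b => G.Adj a.1 b.1) v} :=
    ((measurePreserving_pi _ _ fun _ => hfst).measureReal_preimage
      (Set.toFinite _).measurableSet.nullMeasurableSet).symm
  have hpairing : finiteStonePairing (graphMatroid C G τ c).E evenCycleFormula =
      (Measure.pi fun _ : Fin 4 => μ).real {v | EvenCycle (fun a b => LineAdj (e a) (e b)) v} := by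
    rw [finiteStonePairing_eq_measureReal e]
    simp only [realize_evenCycleFormula]
    rfl
  rw [hpairing, hpull]
  refine abs_measureReal_evenCycle_sub_le.trans ?_
  linarith [measureReal_lineAdj_graphMatroid_ne_adj_le hτ hc e fun _ => rfl]

theorem abs_finiteStonePairing_orthogonalityGraph_sub_le {ι : Type*} [Fintype ι]
    {τ : (ι → ZMod 2) → F} (hτ : Function.Injective τ) (hc : IsGenericRatio τ c) :
    |finiteStonePairing
        (graphMatroid ((ι → ZMod 2) × (ι → ZMod 2)) (orthogonalityGraph ι) τ c).E
        evenCycleFormula - 1 / 2| ≤ 25 / 2 * (Nat.card (ι → ZMod 2) : ℝ)⁻¹ := by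
  have happrox := abs_finiteStonePairing_graphMatroid_sub_le
    (C := (ι → ZMod 2) × (ι → ZMod 2)) (G := orthogonalityGraph ι) hτ hc
  have hrandom := abs_measureReal_evenCycle_orthogonalityGraph_sub_le (ι := ι)
  have hpos : 0 < (Nat.card (ι → ZMod 2) : ℝ) := Nat.cast_pos.2 Nat.card_pos
  have hratio : (Nat.card (ι → ZMod 2) : ℝ) /
      (Nat.card ((ι → ZMod 2) × (ι → ZMod 2)) + Nat.card (ι → ZMod 2)) ≤
        (Nat.card (ι → ZMod 2) : ℝ)⁻¹ := by
    rw [Nat.card_prod, Nat.cast_mul, div_le_iff₀ (by positivity), mul_add,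
      inv_mul_cancel_left₀ hpos.ne', inv_mul_cancel₀ hpos.ne']
    exact le_add_of_nonneg_right zero_le_one
  refine (abs_sub_le _ _ _).trans ((add_le_add happrox hrandom).trans ?_)
  linarith

end Approximation

theorem exists_matroid_abs_finiteStonePairing_sub_le (F : Type*) [Field F] [Infinite F] {m : ℕ}
    (hm : 2 ≤ m) : ∃ (α : Type) (M : Matroid α), M.Finite ∧ M.eRank = 3 ∧
      M.IsRepresentableOver F ∧
      |finiteStonePairing M.E evenCycleFormula - 1 / 2| ≤ 25 / 2 * (1 / 2) ^ m := by
  let V := Fin m → ZMod 2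
  have hcard : Nat.card V = 2 ^ m := by simp [V]
  have htwo : 2 < Fintype.card V := by
    rw [← Nat.card_eq_fintype_card, hcard]
    exact (by norm_num : 2 < 2 ^ 2).trans_le (Nat.pow_le_pow_right two_pos hm)
  obtain ⟨i, j, k, hij, hik, hjk⟩ := Fintype.two_lt_card_iff.1 htwo
  let τ : V ↪ F := ((Finite.equivFin V).toEmbedding.trans Fin.valEmbedding).trans
    (Infinite.natEmbedding F)
  obtain ⟨c, hc⟩ := exists_isGenericRatio τ.injective
  refine ⟨_, graphMatroid (V × V) (orthogonalityGraph (Fin m)) τ c, ⟨Set.toFinite _⟩,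
    eRank_graphMatroid τ.injective hij hik hjk, ⟨3, _, fun _ _ => Iff.rfl⟩, ?_⟩
  have hpairing := abs_finiteStonePairing_orthogonalityGraph_sub_le τ.injective hc
  rwa [hcard, Nat.cast_pow, Nat.cast_ofNat, ← inv_pow, ← one_div] at hpairing

theorem theoremt_general (F : Type*) [Field F] [Infinite F] :
    ∃ (α : ℕ → Type) (M : ∀ n, Matroid (α n)),
      (∀ n, (M n).Finite ∧ (M n).eRank = 3 ∧ (M n).IsRepresentableOver F) ∧
      FOConvergent matroidLanguage (fun n => (M n).E) ∧
      ∀ (A : Type u) [matroidLanguage.Structure A] [MeasurableSpace A] (ν : Measure A)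
        [IsProbabilityMeasure ν],
        (∀ (k : ℕ) (φ : matroidLanguage.Formula (Fin k)),
          NullMeasurableSet {v : Fin k → A | φ.Realize v} (Measure.pi fun _ => ν)) →
        ¬ ∀ (k : ℕ) (φ : matroidLanguage.Formula (Fin k)),
          Tendsto (fun n => finiteStonePairing (M n).E φ) atTop
            (𝓝 ((Measure.pi fun _ : Fin k => ν).real {v | φ.Realize v})) := by
  choose α M hfin hrank hrep hpairing using fun n : ℕ =>
    exists_matroid_abs_finiteStonePairing_sub_le F (Nat.le_add_left 2 n)
  have hE (n : ℕ) : Finite (M n).E := (hfin n).ground_finite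
  obtain ⟨s, hs, hconv⟩ := exists_foConvergent_subseq (L := matroidLanguage) fun n => (M n).E
  refine ⟨fun n => α (s n), fun n => M (s n), fun n => ⟨hfin _, hrank _, hrep _⟩, hconv, ?_⟩
  intro A _ _ ν _ hmeas hlim
  have hgeom : Tendsto (fun n : ℕ => 25 / 2 * (1 / 2 : ℝ) ^ (n + 2)) atTop (𝓝 0) := by
    simpa using ((tendsto_pow_atTop_nhds_zero_of_lt_one (by norm_num) (by norm_num :
      (1 / 2 : ℝ) < 1)).comp (tendsto_add_atTop_nat 2)).const_mul (25 / 2)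
  have hhalf : Tendsto (fun n => finiteStonePairing (M n).E evenCycleFormula) atTop
      (𝓝 (1 / 2)) :=
    tendsto_iff_dist_tendsto_zero.2 (squeeze_zero (fun _ => dist_nonneg) hpairing hgeom)
  exact measureReal_realize_evenCycleFormula_ne_half (hmeas 2 (lineAdjFormula 0 1))
    (tendsto_nhds_unique (hlim 4 evenCycleFormula) (hhalf.comp hs.tendsto_atTop))

theorem theoremt :
    ∃ (α : ℕ → Type) (M : ∀ n, Matroid (α n)),
      (∀ n, (M n).Finite ∧ (M n).eRank = 3 ∧ (M n).IsRepresentableOver ℚ) ∧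
      FOConvergent matroidLanguage (fun n => (M n).E) ∧
      ¬ ∃ A : FOModeling.{u} matroidLanguage, A.IsMatroidLimitModeling M := by
  obtain ⟨α, M, hM, hconv, hlim⟩ := theoremt_general.{u} ℚ
  exact ⟨α, M, hM, hconv, fun ⟨A, hA⟩ => hlim A.carrier A.ν A.measurable_definable hA.2⟩
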